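/- Let $n\ge 1$ and $d\ge 2$. Identify a real symmetric tensor $T$ of order $d$ on $\mathbb{R}^{n+1}$ with the homogeneous polynomial $p_T(x)=\langle T,x^{\otimes d}\rangle$ of degree $d$ in $x_0,\dots,x_n$. Equip $\mathbb{R}[x_0,\dots,x_n]_{(d)}$ with the Bombieri--Weyl scalar product, for which the polynomials $\binom{d}{\alpha}^{1/2}x^{\alpha}$, $|\alpha|=d$, form an orthonormal basis, and equip the space of all tensors with the Frobenius scalar product. Let $\mathcal{V}_{n,d}=\{\pm\ell^d : \ell \text{ a linear form on } \mathbb{R}^{n+1}\}$ (the polynomials of the symmetric rank-one tensors $\pm v^{\otimes d}$; the zero tensor is allowed), and let $V_{n,d}$ be the intersection of $\mathcal{V}_{n,d}$ with the Bombieri--Weyl unit sphere $S^N$. Let $\rho(V_{n,d})$ be the reach of $V_{n,d}$ in $S^N$, that is, the supremum of all $\varepsilon\ge 0$ such that the exponential map of $S^N$, restricted to the normal vectors of $V_{n,d}$ of norm less than $\varepsilon$, is a diffeomorphism onto its image. Let $T$ be a symmetric tensor and $p=p_T$, and suppose that $$\mathrm{dist}_{\mathrm{BW}}(p,\mathcal{V}_{n,d})<\sin(\rho(V_{n,d}))\,\|p\|_{\mathrm{BW}}.$$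 Then $T$ has a unique best rank-one approximation. More precisely: there is exactly one point of $\mathcal{V}_{n,d}$ nearest to $p$ in the Bombieri--Weyl distance; there is exactly one tensor $S$ nearest to $T$ in the Frobenius distance among all tensors of the form $v_1\otimes\cdots\otimes v_d$ with $v_1,\dots,v_d\in\mathbb{R}^{n+1}$ (symmetric or not); and this $S$ is symmetric, with $p_S$ the nearest point of $\mathcal{V}_{n,d}$ to $p$. -/

import Mathlib

open scoped ContDiff RealInnerProductSpace

noncomputable section

namespace SymTensor

/-! ### Smooth maps between subsets of normed spaces -/

/-- Smoothness of a map on an arbitrary subset `A` of a normed space: near every point of `A`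
the map is the restriction of a smooth map defined on an open set. -/
def SmoothOnSubset {G H : Type*} [NormedAddCommGroup G] [NormedSpace ℝ G]
    [NormedAddCommGroup H] [NormedSpace ℝ H] (f : G → H) (A : Set G) : Prop :=
  ∀ x ∈ A, ∃ U : Set G, IsOpen U ∧ x ∈ U ∧
    ∃ f' : G → H, ContDiffOn ℝ ∞ f' U ∧ ∀ y ∈ A ∩ U, f' y = f y

/-- `f` restricts to a diffeomorphism of `A` onto its image: it is smooth and injective on `A`,
and the inverse map `f '' A → A` is smooth. -/
def IsDiffeoOntoImage {G H : Type*} [NormedAddCommGroup G] [NormedSpace ℝ G]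
    [NormedAddCommGroup H] [NormedSpace ℝ H] (f : G → H) (A : Set G) : Prop :=
  SmoothOnSubset f A ∧ Set.InjOn f A ∧
    ∃ g : H → G, (∀ x ∈ A, g (f x) = x) ∧ SmoothOnSubset g (f '' A)

/-! ### The reach of a submanifold of the unit sphere of a Euclidean space -/

section Reach

variable {E : Type*} [NormedAddCommGroup E] [InnerProductSpace ℝ E]

/-- The tangent vectors to `M` at `x`: velocities at time `0` of smooth curves in `M` through
`x`. For a submanifold `M` this is the tangent space. -/
def tangentVectors (M : Set E) (x : E) : Set E :=
  {v | ∃ γ : ℝ → E, ContDiff ℝ ∞ γ ∧ (∀ t, γ t ∈ M) ∧ γ 0 = x ∧ deriv γ 0 = v}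

/-- The normal space at `x` of a submanifold `M` of the unit sphere: vectors tangent to the sphere
at `x` (that is, orthogonal to `x`) and orthogonal to every tangent vector of `M` at `x`. -/
def normalSpace (M : Set E) (x : E) : Set E :=
  {w | ⟪x, w⟫ = 0 ∧ ∀ v ∈ tangentVectors M x, ⟪v, w⟫ = 0}

/-- The `ε`-small normal bundle of `M` in the unit sphere, as a subset of `E × E`. -/
def smallNormalBundle (M : Set E) (ε : ℝ) : Set (E × E) :=
  {z | z.1 ∈ M ∧ z.2 ∈ normalSpace M z.1 ∧ ‖z.2‖ < ε}

/-- The exponential map of the unit sphere, `exp_x(w) = cos ‖w‖ x + (sin ‖w‖ / ‖w‖) w` (and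
`exp_x(0) = x`). -/
def sphereExp (z : E × E) : E :=
  Real.cos ‖z.2‖ • z.1 + Real.sinc ‖z.2‖ • z.2

/-- The reach of a submanifold `M` of the unit sphere of `E`: the supremum of the `ε ≥ 0` such that
the exponential map is a diffeomorphism of the `ε`-small normal bundle of `M` onto its image. -/
def sphericalReach (M : Set E) : ℝ :=
  sSup {ε : ℝ | 0 ≤ ε ∧ IsDiffeoOntoImage (sphereExp (E := E)) (smallNormalBundle M ε)}

end Reach

/-! ### Homogeneous polynomials with the Bombieri–Weyl scalar product -/

/-- Real homogeneous polynomials of degree `d` in the `n + 1` variables `x_0, …, x_n`. -/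
abbrev HomPoly (n d : ℕ) : Type :=
  ↥(MvPolynomial.homogeneousSubmodule (Fin (n + 1)) ℝ d)

/-- The Bombieri–Weyl scalar product, for which the polynomials `(d choose α)^(1/2) x^α` with
`|α| = d` form an orthonormal basis. -/
def bwInner {n d : ℕ} (p q : HomPoly n d) : ℝ :=
  ∑ α ∈ Finset.finsuppAntidiag (Finset.univ : Finset (Fin (n + 1))) d,
    ((α.multinomial : ℝ))⁻¹ * (p.1.coeff α * q.1.coeff α)

lemma multinomial_pos {ι : Type*} (α : ι →₀ ℕ) : (0 : ℝ) < (α.multinomial : ℝ) := by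
  exact_mod_cast Nat.multinomial_pos _ _

/-- The inner product space axioms for the Bombieri–Weyl scalar product. -/
@[reducible]
def bwCore (n d : ℕ) : InnerProductSpace.Core ℝ (HomPoly n d) where
  inner := bwInner
  conj_inner_symm p q := by
    simp only [bwInner, conj_trivial, mul_comm]
  re_inner_nonneg p := by
    simp only [bwInner, RCLike.re_to_real]
    exact Finset.sum_nonneg fun α _ =>
      mul_nonneg (inv_nonneg.2 (multinomial_pos α).le) (mul_self_nonneg _)
  add_left p q r := by
    simp only [bwInner, ← Finset.sum_add_distrib]
    refine Finset.sum_congr rfl fun α _ => ?_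
    simp only [Submodule.coe_add, MvPolynomial.coeff_add]
    ring
  smul_left p q c := by
    simp only [bwInner, Finset.mul_sum, conj_trivial]
    refine Finset.sum_congr rfl fun α _ => ?_
    simp only [Submodule.coe_smul, MvPolynomial.coeff_smul, smul_eq_mul]
    ring
  definite p h := by
    have h0 := (Finset.sum_eq_zero_iff_of_nonneg fun α _ =>
      mul_nonneg (inv_nonneg.2 (multinomial_pos α).le)
        (mul_self_nonneg (p.1.coeff α))).1 h
    apply Subtype.ext
    ext α
    by_contra hα
    have hdeg : α.degree = d := by
      rw [Finsupp.degree_eq_weight_one]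
      exact p.2 hα
    have hmem : α ∈ Finset.finsuppAntidiag (Finset.univ : Finset (Fin (n + 1))) d := by
      rw [Finset.mem_finsuppAntidiag]
      refine ⟨?_, Finset.subset_univ _⟩
      rw [← hdeg, Finsupp.degree_eq_sum]
    have h1 := h0 α hmem
    rcases mul_eq_zero.1 h1 with h2 | h2
    · exact (inv_ne_zero (multinomial_pos α).ne') h2
    · exact hα (by simpa using h2)

instance instNormedAddCommGroupHomPoly (n d : ℕ) : NormedAddCommGroup (HomPoly n d) :=
  (bwCore n d).toNormedAddCommGroup

instance instInnerProductSpaceHomPoly (n d : ℕ) : InnerProductSpace ℝ (HomPoly n d) :=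
  InnerProductSpace.ofCore (bwCore n d).toCore

/-- The `d`-th power of the linear form `x ↦ v_0 x_0 + ⋯ + v_n x_n`. -/
def linearPow (n d : ℕ) (v : Fin (n + 1) → ℝ) : HomPoly n d :=
  ⟨(∑ i, MvPolynomial.C (v i) * MvPolynomial.X i) ^ d, by
    have h : (∑ i, MvPolynomial.C (v i) * MvPolynomial.X i :
        MvPolynomial (Fin (n + 1)) ℝ).IsHomogeneous 1 :=
      MvPolynomial.IsHomogeneous.sum _ _ _ fun i _ => by
        simpa using (MvPolynomial.isHomogeneous_C (Fin (n + 1)) (v i)).mul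
          (MvPolynomial.isHomogeneous_X ℝ i)
    simpa using h.pow d⟩

/-- The Veronese variety: signed `d`-th powers of linear forms. These are the polynomials of the
symmetric tensors of rank one `± v ⊗ ⋯ ⊗ v`. -/
def veroneseVariety (n d : ℕ) : Set (HomPoly n d) :=
  {q | ∃ v : Fin (n + 1) → ℝ, q = linearPow n d v ∨ q = -linearPow n d v}

/-- The spherical Veronese variety `V_{n,d}`: the intersection of the Veronese variety with the
unit sphere of the Bombieri–Weyl norm. -/
def sphericalVeronese (n d : ℕ) : Set (HomPoly n d) :=
  veroneseVariety n d ∩ Metric.sphere 0 1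

/-! ### Tensors -/

/-- Real tensors of order `d` on `ℝ^(n+1)`, given by their coordinates in the basis
`e_{i_1} ⊗ ⋯ ⊗ e_{i_d}`, with the Frobenius scalar product. -/
abbrev Tensor (n d : ℕ) : Type := EuclideanSpace ℝ (Fin d → Fin (n + 1))

/-- Invariance under permutations of the tensor factors. -/
def IsSymmetric {n d : ℕ} (T : Tensor n d) : Prop :=
  ∀ (σ : Equiv.Perm (Fin d)) (i : Fin d → Fin (n + 1)), T (i ∘ σ) = T i

/-- All (not necessarily symmetric) decomposable tensors `v_1 ⊗ ⋯ ⊗ v_d`. -/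
def rankOneTensors (n d : ℕ) : Set (Tensor n d) :=
  {T | ∃ v : Fin d → Fin (n + 1) → ℝ, ∀ i : Fin d → Fin (n + 1), T i = ∏ k, v k (i k)}

/-- The homogeneous polynomial `p_T(x) = ⟨T, x ⊗ ⋯ ⊗ x⟩` of a tensor `T`. -/
def polyOfTensor {n d : ℕ} (T : Tensor n d) : HomPoly n d :=
  ⟨∑ i : Fin d → Fin (n + 1), MvPolynomial.C (T i) * ∏ k, MvPolynomial.X (i k), by
    refine MvPolynomial.IsHomogeneous.sum _ _ _ fun i _ => ?_
    have h := (MvPolynomial.isHomogeneous_C (Fin (n + 1)) (T i)).mul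
      (MvPolynomial.IsHomogeneous.prod Finset.univ
        (fun k => (MvPolynomial.X (i k) : MvPolynomial (Fin (n + 1)) ℝ)) (fun _ => 1)
        fun k _ => MvPolynomial.isHomogeneous_X ℝ (i k))
    simpa using h⟩

/-- `y` is a best approximation of `x` by elements of `A`. -/
def IsBestApprox {X : Type*} [MetricSpace X] (A : Set X) (x y : X) : Prop :=
  y ∈ A ∧ ∀ z ∈ A, dist x y ≤ dist x z

end SymTensor

end

/-!
The proof has two independent ingredients.

*Uniqueness within the reach.* Write `L` for the largest value of `⟪p, ·⟫` on the unit vectors of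
a cone closed under real scaling. The nearest points of the cone to `p` are the points `L • u` with
`u` a unit vector of the cone at which `L` is attained, and the distance is `√(‖p‖² - L²)`
(`isBestApprox_cone_iff`, `infDist_sq_cone`). Hence the hypothesis on the distance says that the
spherical distance `θ` from `p / ‖p‖` to the unit vectors of the cone satisfies `sin θ < sin ρ`,
which forces `θ < ρ` since `θ ≤ π / 2`. If `u` is a nearest point on the sphere, then `p / ‖p‖` is
the exponential of a vector at `u` of length `θ`, which is normal by the first-order condition; so
injectivity of the exponential map on the small normal bundle makes `u` unique
(`eq_of_lt_sphericalReach`, `eq_of_infDist_lt_sin_sphericalReach`).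

*Symmetry of the best rank-one approximations.* By the reproducing property of the Bombieri–Weyl
product (`inner_linearPow`), approximating `p_T` by signed powers and `T` by decomposable tensors
amounts to maximizing the symmetric multilinear form `F(v) = ⟪T, v_1 ⊗ ⋯ ⊗ v_d⟫` in absolute value
over unit vectors, on the diagonal and everywhere. Banach's theorem says that the two maxima agree.
Its refinement `exists_diagonal_abs_map_eq` says more: a vector `h` that is not orthogonal to all
entries of a maximizing tuple is not orthogonal to `y` for some maximizing diagonal tuple
`(y, …, y)`. Here the diagonal maximizer `(x, …, x)` is unique up to sign, so every `h` orthogonal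
to `x` is orthogonal to every entry of every maximizing tuple. All these entries are then multiples
of `x`, and the best rank-one approximation is a multiple of `x ⊗ ⋯ ⊗ x`, with the factor
determined by its scalar product with `T`.
-/

namespace SymTensor

/-! ### Nearest points within the reach of a subset of the sphere -/

section Reach

variable {E : Type*} [NormedAddCommGroup E] [InnerProductSpace ℝ E]

/-- The logarithm on the sphere: a unit vector `y` at spherical distance `θ < π` from the unit
vector `x` is the exponential of a tangent vector of length `θ` in the plane of `x` and `y`. -/
lemma sphereExp_log {x y : E} (hx : ‖x‖ = 1) (hy : ‖y‖ = 1) {θ : ℝ} (hθ0 : 0 ≤ θ)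
    (hθπ : θ < Real.pi) (hxy : ⟪x, y⟫ = Real.cos θ) :
    ‖(Real.sinc θ)⁻¹ • (y - Real.cos θ • x)‖ = θ ∧
      sphereExp (x, (Real.sinc θ)⁻¹ • (y - Real.cos θ • x)) = y := by
  have hs : 0 < Real.sinc θ := by
    rcases hθ0.eq_or_lt with rfl | h
    · simp
    · rw [Real.sinc_of_ne_zero h.ne']
      exact div_pos (Real.sin_pos_of_pos_of_lt_pi h hθπ) h
  have hsin : Real.sinc θ * θ = Real.sin θ := by
    rcases hθ0.eq_or_lt with rfl | h
    · simp
    · rw [Real.sinc_of_ne_zero h.ne', div_mul_cancel₀ _ h.ne']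
  have hn : ‖y - Real.cos θ • x‖ = Real.sin θ := by
    rw [← sq_eq_sq₀ (norm_nonneg _) (Real.sin_nonneg_of_nonneg_of_le_pi hθ0 hθπ.le),
      norm_sub_sq_real, norm_smul, inner_smul_right, real_inner_comm, hxy, hx, hy, Real.sin_sq,
      Real.norm_eq_abs, mul_one, sq_abs]
    ring
  have hw : ‖(Real.sinc θ)⁻¹ • (y - Real.cos θ • x)‖ = θ := by
    rw [norm_smul, hn, Real.norm_eq_abs, abs_of_pos (inv_pos.2 hs), ← hsin,
      inv_mul_cancel_left₀ hs.ne']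
  refine ⟨hw, ?_⟩
  simp only [sphereExp]
  rw [hw, smul_inv_smul₀ hs.ne', add_sub_cancel]

/-- First-order condition: if the linear function `⟪·, y⟫` is maximal on a subset `M` of the sphere
at `x`, then the component of `y` orthogonal to `x` is normal to `M`. -/
lemma mem_normalSpace_of_isMaxOn {M : Set E} (hM : M ⊆ Metric.sphere 0 1) {x y : E} (hx : x ∈ M)
    (hmax : IsMaxOn (fun z => ⟪z, y⟫) M x) (c : ℝ) :
    c • (y - ⟪x, y⟫ • x) ∈ normalSpace M x := by
  have hunit : ∀ z ∈ M, ‖z‖ = 1 := fun z hz => by simpa using hM hz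
  refine ⟨?_, ?_⟩
  · rw [inner_smul_right, inner_sub_right, inner_smul_right, real_inner_self_eq_norm_sq,
      hunit x hx]
    ring
  · rintro v ⟨γ, hγ, hγM, hγ0, rfl⟩
    have hd : HasDerivAt γ (deriv γ 0) 0 :=
      ((hγ.differentiable (by simp)) 0).hasDerivAt
    have h1 : ⟪deriv γ 0, y⟫ = 0 := by
      have h := hd.inner ℝ (hasDerivAt_const (0 : ℝ) y)
      have hloc : IsLocalMax (fun t => ⟪γ t, y⟫) 0 :=
        Filter.Eventually.of_forall fun t => by
          simp only [hγ0]
          exact hmax (hγM t)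
      simpa using hloc.hasDerivAt_eq_zero h
    have h2 : ⟪deriv γ 0, x⟫ = 0 := by
      have h := hd.inner ℝ hd
      have hconst : (fun t => ⟪γ t, γ t⟫) = fun _ => (1 : ℝ) := by
        funext t
        rw [real_inner_self_eq_norm_sq, hunit _ (hγM t), one_pow]
      rw [hconst] at h
      have h0 := h.unique (hasDerivAt_const (0 : ℝ) (1 : ℝ))
      rw [hγ0, real_inner_comm (deriv γ 0) x] at h0
      linarith
    rw [inner_smul_right, inner_sub_right, inner_smul_right, h1, h2]
    ring

/-- Within the reach, nearest points are unique: a unit vector `y` at spherical distance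
`θ < ρ(M)` from `M` has only one nearest point on `M`. -/
theorem eq_of_lt_sphericalReach {M : Set E} (hM : M ⊆ Metric.sphere 0 1) {y : E} (hy : ‖y‖ = 1)
    {θ : ℝ} (hθ0 : 0 ≤ θ) (hθπ : θ < Real.pi) (hθ : θ < sphericalReach M)
    (hmax : ∀ z ∈ M, ⟪z, y⟫ ≤ Real.cos θ) {x x' : E} (hx : x ∈ M) (hx' : x' ∈ M)
    (hxy : ⟪x, y⟫ = Real.cos θ) (hxy' : ⟪x', y⟫ = Real.cos θ) : x = x' := by
  have hne : {ε : ℝ | 0 ≤ ε ∧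
      IsDiffeoOntoImage (sphereExp (E := E)) (smallNormalBundle M ε)}.Nonempty := by
    by_contra hempty
    rw [sphericalReach, Set.not_nonempty_iff_eq_empty.1 hempty, Real.sSup_empty] at hθ
    exact hθ.not_ge hθ0
  obtain ⟨ε, ⟨-, -, hinj, -⟩, hε⟩ := exists_lt_of_lt_csSup hne hθ
  have key : ∀ z ∈ M, ⟪z, y⟫ = Real.cos θ →
      (z, (Real.sinc θ)⁻¹ • (y - Real.cos θ • z)) ∈ smallNormalBundle M ε ∧
        sphereExp (z, (Real.sinc θ)⁻¹ • (y - Real.cos θ • z)) = y := by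
    intro z hz hzy
    obtain ⟨hn, hexp⟩ := sphereExp_log (by simpa using hM hz) hy hθ0 hθπ hzy
    refine ⟨⟨hz, ?_, hn.trans_lt hε⟩, hexp⟩
    rw [← hzy]
    exact mem_normalSpace_of_isMaxOn hM hz (fun q hq => (hmax q hq).trans hzy.ge) _
  obtain ⟨h1, h2⟩ := key x hx hxy
  obtain ⟨h1', h2'⟩ := key x' hx' hxy'
  exact congrArg Prod.fst (hinj h1 h1' (h2.trans h2'.symm))

end Reach

/-! ### Nearest points in a cone -/

section Cone

variable {E : Type*} [NormedAddCommGroup E] [InnerProductSpace ℝ E] {C : Set E} {p : E} {L : ℝ}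

lemma norm_sq_sub_sq_le_dist_sq {q : E} (hle : ⟪p, q⟫ ≤ L * ‖q‖) :
    ‖p‖ ^ 2 - L ^ 2 ≤ dist p q ^ 2 := by
  rw [dist_eq_norm, norm_sub_sq_real]
  nlinarith [sq_nonneg (‖q‖ - L)]

lemma dist_sq_eq_of_inner_eq {q : E} (hq : ‖q‖ = L) (hpq : ⟪p, q⟫ = L ^ 2) :
    dist p q ^ 2 = ‖p‖ ^ 2 - L ^ 2 := by
  rw [dist_eq_norm, norm_sub_sq_real, hq, hpq]
  ring

/-- The nearest points of a cone `C` to `p` are the points `L • u`, where `u` runs through the unit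
vectors of `C` at which `⟪p, ·⟫` attains its maximum `L` over the unit vectors of `C`. -/
theorem isBestApprox_cone_iff (hL : 0 ≤ L) (hC : ∀ q ∈ C, ∀ c : ℝ, c • q ∈ C)
    (hle : ∀ q ∈ C, ⟪p, q⟫ ≤ L * ‖q‖) {u : E} (hu : u ∈ C) (hu1 : ‖u‖ = 1) (hpu : ⟪p, u⟫ = L)
    {q : E} : IsBestApprox C p q ↔ q ∈ C ∧ ‖q‖ = L ∧ ⟪p, q⟫ = L ^ 2 := by
  constructor
  · rintro ⟨hq, hbest⟩
    have h1 := hbest _ (hC u hu L)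
    have h2 : dist p q ^ 2 ≤ ‖p‖ ^ 2 - L ^ 2 := by
      rw [← dist_sq_eq_of_inner_eq (p := p) (q := L • u) (L := L)
        (by rw [norm_smul, hu1, Real.norm_eq_abs, abs_of_nonneg hL, mul_one])
        (by rw [inner_smul_right, hpu, sq])]
      gcongr
    rw [dist_eq_norm, norm_sub_sq_real] at h2
    have h3 := hle q hq
    have h4 : ‖q‖ = L := by
      have : (‖q‖ - L) ^ 2 ≤ 0 := by nlinarith
      have := pow_eq_zero_iff (two_ne_zero) |>.1 (le_antisymm this (sq_nonneg _))
      linarith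
    refine ⟨hq, h4, ?_⟩
    rw [h4] at h2 h3
    nlinarith
  · rintro ⟨hq, hq1, hpq⟩
    refine ⟨hq, fun z hz => ?_⟩
    rw [← sq_le_sq₀ dist_nonneg dist_nonneg, dist_sq_eq_of_inner_eq hq1 hpq]
    exact norm_sq_sub_sq_le_dist_sq (hle z hz)

theorem infDist_sq_cone (hL : 0 ≤ L) (hC : ∀ q ∈ C, ∀ c : ℝ, c • q ∈ C)
    (hle : ∀ q ∈ C, ⟪p, q⟫ ≤ L * ‖q‖) {u : E} (hu : u ∈ C) (hu1 : ‖u‖ = 1) (hpu : ⟪p, u⟫ = L) :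
    Metric.infDist p C ^ 2 = ‖p‖ ^ 2 - L ^ 2 := by
  have h1 : ‖L • u‖ = L := by rw [norm_smul, hu1, Real.norm_eq_abs, abs_of_nonneg hL, mul_one]
  have h2 : ⟪p, L • u⟫ = L ^ 2 := by rw [inner_smul_right, hpu, sq]
  have hbest := (isBestApprox_cone_iff hL hC hle hu hu1 hpu).2 ⟨hC u hu L, h1, h2⟩
  rw [← dist_sq_eq_of_inner_eq h1 h2]
  congr 1
  exact le_antisymm (Metric.infDist_le_dist_of_mem hbest.1)
    ((Metric.le_infDist ⟨_, hbest.1⟩).2 fun _ hz => hbest.2 _ hz)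

/-- If `p` is closer to a symmetric cone `C` than `sin ρ ‖p‖`, where `ρ` is the reach of the unit
vectors of `C`, then `p` has exactly one nearest point in `C`. -/
theorem eq_of_infDist_lt_sin_sphericalReach (hL : 0 ≤ L) (hC : ∀ q ∈ C, ∀ c : ℝ, c • q ∈ C)
    (hle : ∀ q ∈ C, ⟪p, q⟫ ≤ L * ‖q‖) {u : E} (hu : u ∈ C) (hu1 : ‖u‖ = 1) (hpu : ⟪p, u⟫ = L)
    (hdist : Metric.infDist p C < Real.sin (sphericalReach (C ∩ Metric.sphere 0 1)) * ‖p‖) :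
    0 < L ∧ ∀ q q' : E, IsBestApprox C p q → IsBestApprox C p q' → q = q' := by
  have hinf := infDist_sq_cone hL hC hle hu hu1 hpu
  set ρ := sphericalReach (C ∩ Metric.sphere 0 1) with hρ
  have hd0 : 0 ≤ Metric.infDist p C := Metric.infDist_nonneg
  have hp : 0 < ‖p‖ := by
    rcases (norm_nonneg p).eq_or_lt with h | h
    · rw [← h, mul_zero] at hdist
      exact absurd hdist hd0.not_gt
    · exact h
  have hLpos : 0 < L := by
    have h1 : Metric.infDist p C < ‖p‖ :=
      hdist.trans_le (mul_le_of_le_one_left hp.le (Real.sin_le_one _))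
    rcases hL.eq_or_lt with h | h
    · rw [← h] at hinf
      nlinarith
    · exact h
  refine ⟨hLpos, fun q q' hq hq' => ?_⟩
  rw [isBestApprox_cone_iff hL hC hle hu hu1 hpu] at hq hq'
  have hLp : L ≤ ‖p‖ := by nlinarith
  -- `θ` is the spherical distance from `p / ‖p‖` to the unit vectors of `C`
  set θ := Real.arccos (L / ‖p‖) with hθ
  have hcos : Real.cos θ = L / ‖p‖ := by
    refine Real.cos_arccos ?_ ?_
    · have : 0 ≤ L / ‖p‖ := by positivity
      linarith
    · exact (div_le_one hp).2 hLp
  have hθ0 : 0 ≤ θ := Real.arccos_nonneg _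
  have hθ2 : θ ≤ Real.pi / 2 := Real.arccos_le_pi_div_two.2 (by positivity)
  have hsin : Real.sin θ * ‖p‖ = Metric.infDist p C := by
    rw [← sq_eq_sq₀ (mul_nonneg (Real.sin_nonneg_of_nonneg_of_le_pi hθ0
      (by linarith [Real.pi_pos])) hp.le) hd0, hinf, mul_pow, Real.sin_sq, hcos]
    field_simp
  have hθρ : θ < ρ := by
    by_contra! hle'
    -- the reach is nonnegative, whether or not the supremum defining it is finite
    have hρ0 : 0 ≤ ρ := Real.sSup_nonneg fun ε hε => hε.1
    have := Real.sin_le_sin_of_le_of_le_pi_div_two (by linarith [Real.pi_pos]) hθ2 hle'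
    rw [← hsin] at hdist
    exact absurd hdist (not_lt.2 (by gcongr))
  have hmem : ∀ z, z ∈ C ∧ ‖z‖ = L ∧ ⟪p, z⟫ = L ^ 2 →
      L⁻¹ • z ∈ C ∩ Metric.sphere 0 1 ∧ ⟪L⁻¹ • z, ‖p‖⁻¹ • p⟫ = Real.cos θ := by
    rintro z ⟨hz, hz1, hz2⟩
    refine ⟨⟨hC z hz _, ?_⟩, ?_⟩
    · rw [mem_sphere_zero_iff_norm, norm_smul, hz1, Real.norm_eq_abs, abs_of_pos (by positivity),
        inv_mul_cancel₀ hLpos.ne']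
    · rw [inner_smul_left, inner_smul_right, real_inner_comm, hz2, hcos]
      simp only [conj_trivial]
      field_simp
  obtain ⟨h1, h2⟩ := hmem q hq
  obtain ⟨h1', h2'⟩ := hmem q' hq'
  have hpi := Real.pi_pos
  have := eq_of_lt_sphericalReach (M := C ∩ Metric.sphere 0 1) Set.inter_subset_right
    (y := ‖p‖⁻¹ • p) (by rw [norm_smul, norm_inv, norm_norm, inv_mul_cancel₀ hp.ne'])
    hθ0 (by linarith) hθρ (fun z hz => ?_) h1 h1' h2 h2'
  · exact smul_right_injective E (inv_ne_zero hLpos.ne') this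
  · have := hle z hz.1
    rw [mem_sphere_zero_iff_norm.1 hz.2, mul_one] at this
    rw [inner_smul_right, real_inner_comm, hcos, div_eq_inv_mul]
    gcongr

end Cone

/-! ### Banach's theorem on symmetric multilinear forms -/

section Banach

variable {ι E : Type*} [NormedAddCommGroup E] [InnerProductSpace ℝ E]
  {F : MultilinearMap ℝ (fun _ : ι => E) ℝ} {L : ℝ}

lemma abs_map_le_mul_prod_norm [Fintype ι] (hle : ∀ v : ι → E, (∀ i, ‖v i‖ = 1) → |F v| ≤ L) (v : ι → E) :
    |F v| ≤ L * ∏ i, ‖v i‖ := by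
  by_cases h : ∃ i, v i = 0
  · obtain ⟨i, hi⟩ := h
    rw [F.map_coord_zero i hi, Finset.prod_eq_zero (Finset.mem_univ i) (by rw [hi, norm_zero])]
    simp
  · push Not at h
    have h1 := hle (fun i => ‖v i‖⁻¹ • v i) fun i => by
      rw [norm_smul, norm_inv, norm_norm, inv_mul_cancel₀ (norm_ne_zero_iff.2 (h i))]
    have hpos : 0 < ∏ i, ‖v i‖ := Finset.prod_pos fun i _ => norm_pos_iff.2 (h i)
    rw [F.map_smul_univ, smul_eq_mul, abs_mul, Finset.prod_inv_distrib, abs_inv,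
      abs_of_pos hpos, inv_mul_le_iff₀ hpos] at h1
    rwa [mul_comm]

/-- A multilinear form on a nonzero finite-dimensional space attains its norm. -/
lemma exists_unit_abs_map_max [FiniteDimensional ℝ E] [Nontrivial E] (hcont : Continuous F) :
    ∃ v : ι → E, (∀ i, ‖v i‖ = 1) ∧ ∀ w : ι → E, (∀ i, ‖w i‖ = 1) → |F w| ≤ |F v| := by
  have hS : IsCompact (Set.univ.pi fun _ : ι => Metric.sphere (0 : E) 1) :=
    isCompact_univ_pi fun _ => isCompact_sphere 0 1
  obtain ⟨e, he⟩ := exists_norm_eq E zero_le_one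
  obtain ⟨v, hv, hmax⟩ := hS.exists_isMaxOn (f := fun w => |F w|)
    ⟨fun _ => e, fun _ _ => by simpa using he⟩ hcont.abs.continuousOn
  exact ⟨v, fun i => by simpa using hv i trivial, fun w hw => hmax fun i _ => by simpa using hw i⟩

variable [DecidableEq ι]

lemma abs_map_update_update_le (hle : ∀ v : ι → E, (∀ i, ‖v i‖ = 1) → |F v| ≤ L) {v : ι → E}
    (hv : ∀ i, ‖v i‖ = 1) {i j : ι} (hij : i ≠ j) (a : E) :
    |F (Function.update (Function.update v i a) j a)| ≤ L * ‖a‖ ^ 2 := by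
  rcases eq_or_ne a 0 with rfl | ha
  · rw [F.map_coord_zero j (Function.update_self ..)]
    simp
  · have hpos := norm_pos_iff.2 ha
    have hb : ‖‖a‖⁻¹ • a‖ = 1 := by
      rw [norm_smul, norm_inv, norm_norm, inv_mul_cancel₀ hpos.ne']
    have h := hle (Function.update (Function.update v i (‖a‖⁻¹ • a)) j (‖a‖⁻¹ • a)) fun k => by
      simp only [Function.update_apply]
      split_ifs <;> simp [hb, hv]
    rw [F.map_update_smul, Function.update_comm hij, F.map_update_smul,
      Function.update_comm hij.symm, smul_eq_mul, smul_eq_mul, abs_mul, abs_mul, abs_inv,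
      abs_norm] at h
    field_simp at h
    rwa [mul_comm] at h

/-- The polarization step: if a tuple of unit vectors maximizes a symmetric multilinear form in
absolute value, then two entries may both be replaced by their normalized sum. Indeed
`4 B(u, w) = B(u + w, u + w) - B(u - w, u - w)` for the bilinear form `B` in these two entries, and
`‖u + w‖² + ‖u - w‖² = 4`. -/
lemma abs_map_update_update_normalize_add
    (hsymm : ∀ (σ : Equiv.Perm ι) (v : ι → E), F (v ∘ σ) = F v)
    (hle : ∀ v : ι → E, (∀ i, ‖v i‖ = 1) → |F v| ≤ L) {v : ι → E}
    (hv : ∀ i, ‖v i‖ = 1) (hFv : |F v| = L) {i j : ι} (hij : i ≠ j) (hne : v i + v j ≠ 0) :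
    |F (Function.update (Function.update v i (‖v i + v j‖⁻¹ • (v i + v j))) j
      (‖v i + v j‖⁻¹ • (v i + v j)))| = L := by
  set B : E → E → ℝ := fun a b => F (Function.update (Function.update v i a) j b) with hB
  have hadd_right : ∀ a b c, B a (b + c) = B a b + B a c := fun a b c => by
    simp only [hB, F.map_update_add]
  have hsmul_right : ∀ (t : ℝ) a b, B a (t • b) = t * B a b := fun t a b => by
    simp only [hB, F.map_update_smul, smul_eq_mul]
  have hcomm : ∀ a b, B a b = B b a := fun a b => by
    simp only [hB]
    rw [← hsymm (Equiv.swap i j)]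
    congr 1
    funext k
    simp only [Function.comp, Function.update_apply, Equiv.swap_apply_def]
    split_ifs <;> simp_all
  have hadd_left : ∀ a b c, B (a + b) c = B a c + B b c := fun a b c => by
    rw [hcomm, hadd_right, hcomm c a, hcomm c b]
  have hsmul_left : ∀ (t : ℝ) a b, B (t • a) b = t * B a b := fun t a b => by
    rw [hcomm, hsmul_right, hcomm]
  have hbound : ∀ a, |B a a| ≤ L * ‖a‖ ^ 2 := abs_map_update_update_le hle hv hij
  have huw : |B (v i) (v j)| = L := by
    simp only [hB, Function.update_eq_self, hFv]
  have hpol : 4 * B (v i) (v j) =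
      B (v i + v j) (v i + v j) - B (v i + (-1 : ℝ) • v j) (v i + (-1 : ℝ) • v j) := by
    simp only [hadd_left, hadd_right, hsmul_left, hsmul_right, hcomm (v j) (v i)]
    ring
  have hpar : ‖v i + v j‖ ^ 2 + ‖v i + (-1 : ℝ) • v j‖ ^ 2 = 4 := by
    rw [neg_one_smul, ← sub_eq_add_neg, norm_add_sq_real, norm_sub_sq_real, hv, hv]
    ring
  have hpos := norm_pos_iff.2 hne
  have hge : L * ‖v i + v j‖ ^ 2 ≤ |B (v i + v j) (v i + v j)| := by
    have h1 : |4 * B (v i) (v j)| = 4 * L := by rw [abs_mul, huw]; norm_num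
    have h2 := abs_sub (B (v i + v j) (v i + v j))
      (B (v i + (-1 : ℝ) • v j) (v i + (-1 : ℝ) • v j))
    rw [← hpol, h1] at h2
    have h3 := hbound (v i + (-1 : ℝ) • v j)
    have h4 : 4 * L = L * ‖v i + v j‖ ^ 2 + L * ‖v i + (-1 : ℝ) • v j‖ ^ 2 := by
      rw [← mul_add, hpar, mul_comm]
    linarith
  have heq := le_antisymm (hbound (v i + v j)) hge
  change |B _ _| = L
  rw [hsmul_left, hsmul_right, abs_mul, abs_mul, heq, abs_inv, abs_norm]
  field_simp

variable [Fintype ι]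

lemma sum_inner_update (h : E) (v : ι → E) (j : ι) (a : E) :
    ∑ k, ⟪h, Function.update v j a k⟫ = ∑ k, ⟪h, v k⟫ - ⟪h, v j⟫ + ⟪h, a⟫ := by
  rw [← Finset.add_sum_erase _ _ (Finset.mem_univ j),
    ← Finset.add_sum_erase _ (fun k => ⟪h, v k⟫) (Finset.mem_univ j)]
  have : ∑ k ∈ Finset.univ.erase j, ⟪h, Function.update v j a k⟫ =
      ∑ k ∈ Finset.univ.erase j, ⟪h, v k⟫ :=
    Finset.sum_congr rfl fun k hk => by
      rw [Function.update_of_ne (Finset.ne_of_mem_erase hk)]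
  rw [this, Function.update_self]
  ring

/-- A refinement of Banach's theorem that a symmetric multilinear form attains its norm on the
diagonal: if the form attains its norm at a tuple of unit vectors not all orthogonal to `h`, then it
attains its norm at a diagonal tuple `(y, …, y)` with `y` not orthogonal to `h`. Among all maximizing
tuples, one that maximizes `∑ ⟪h, v i⟫` has equal entries, as replacing two different entries by
their normalized sum would increase this quantity. -/
theorem exists_diagonal_abs_map_eq [FiniteDimensional ℝ E] (hcont : Continuous F)
    (hsymm : ∀ (σ : Equiv.Perm ι) (v : ι → E), F (v ∘ σ) = F v)
    (hle : ∀ v : ι → E, (∀ i, ‖v i‖ = 1) → |F v| ≤ L) {v : ι → E}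
    (hv : ∀ i, ‖v i‖ = 1) (hFv : |F v| = L) {h : E} {i : ι} (hi : ⟪h, v i⟫ ≠ 0) :
    ∃ y : E, ‖y‖ = 1 ∧ |F fun _ => y| = L ∧ ⟪h, y⟫ ≠ 0 := by
  set K : Set (ι → E) := {w | (∀ k, ‖w k‖ = 1) ∧ |F w| = L} with hK
  have hKc : IsCompact K := by
    have hS : IsCompact (Set.univ.pi fun _ : ι => Metric.sphere (0 : E) 1) :=
      isCompact_univ_pi fun _ => isCompact_sphere 0 1
    have : K = (Set.univ.pi fun _ : ι => Metric.sphere (0 : E) 1) ∩ {w | |F w| = L} := by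
      ext w
      simp [hK]
    rw [this]
    exact hS.inter_right (isClosed_eq hcont.abs continuous_const)
  have hneg : ∀ w ∈ K, ∀ j, Function.update w j (-w j) ∈ K := fun w hw j => by
    refine ⟨fun k => ?_, ?_⟩
    · rw [Function.update_apply]
      split_ifs <;> simp [hw.1]
    · rw [← neg_one_smul ℝ (w j), F.map_update_smul, Function.update_eq_self, neg_one_smul,
        abs_neg, hw.2]
  obtain ⟨w, hwK, hmax⟩ := hKc.exists_isMaxOn ⟨v, hv, hFv⟩
    (f := fun w => ∑ k, ⟪h, w k⟫) (by fun_prop)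
  have hmax' : ∀ z ∈ K, ∑ k, ⟪h, z k⟫ ≤ ∑ k, ⟪h, w k⟫ := fun z hz => hmax hz
  have hnonneg : ∀ k, 0 ≤ ⟪h, w k⟫ := fun k => by
    have := hmax' _ (hneg w hwK k)
    rw [sum_inner_update, inner_neg_right] at this
    linarith
  -- otherwise `w` is orthogonal to `h`, and so are all maximizing tuples, by changing signs
  have hpos : ∃ k, 0 < ⟪h, w k⟫ := by
    by_contra! hall
    have h0 : ∑ k, ⟪h, w k⟫ ≤ 0 := Finset.sum_nonpos fun k _ => hall k
    have hsgn : (fun k => (if ⟪h, v k⟫ < 0 then (-1 : ℝ) else 1) • v k) ∈ K := by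
      refine ⟨fun k => ?_, ?_⟩
      · dsimp only
        split_ifs <;> simp [hv]
      · rw [F.map_smul_univ, smul_eq_mul, abs_mul, Finset.abs_prod, hFv,
          Finset.prod_eq_one fun k _ => by split_ifs <;> simp, one_mul]
    have h1 : ∀ k, ⟪h, (if ⟪h, v k⟫ < 0 then (-1 : ℝ) else 1) • v k⟫ = |⟪h, v k⟫| := fun k => by
      rw [inner_smul_right]
      split_ifs with hk
      · rw [abs_of_neg hk, neg_one_mul]
      · rw [abs_of_nonneg (not_lt.1 hk), one_mul]
    have h2 := (hmax' _ hsgn).trans h0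
    simp only [h1] at h2
    exact absurd h2 (not_le.2 (Finset.sum_pos' (fun k _ => abs_nonneg _)
      ⟨i, Finset.mem_univ i, abs_pos.2 hi⟩))
  obtain ⟨k, hk⟩ := hpos
  have hall : ∀ j, w j = w k := by
    intro j
    by_contra hjk
    have hkj : k ≠ j := fun hkj => hjk (by rw [hkj])
    have hsum : 0 < ⟪h, w k + w j⟫ := by
      rw [inner_add_right]
      linarith [hnonneg j]
    have hne : w k + w j ≠ 0 := fun h0 => by
      rw [h0, inner_zero_right] at hsum
      exact hsum.false
    have hs : ‖‖w k + w j‖⁻¹ • (w k + w j)‖ = 1 := by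
      rw [norm_smul, norm_inv, norm_norm, inv_mul_cancel₀ (norm_ne_zero_iff.2 hne)]
    have hlt : ‖w k + w j‖ < 2 := by
      have h1 : 0 < ‖w k - w j‖ := norm_pos_iff.2 (sub_ne_zero.2 (Ne.symm hjk))
      have h2 := parallelogram_law_with_norm ℝ (w k) (w j)
      rw [hwK.1, hwK.1] at h2
      nlinarith [norm_nonneg (w k + w j)]
    have := hmax' (Function.update (Function.update w k (‖w k + w j‖⁻¹ • (w k + w j))) j
      (‖w k + w j‖⁻¹ • (w k + w j))) ⟨fun l => by
        simp only [Function.update_apply]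
        split_ifs
        exacts [hs, hs, hwK.1 l],
      abs_map_update_update_normalize_add hsymm hle hwK.1 hwK.2 hkj hne⟩
    rw [sum_inner_update, sum_inner_update, Function.update_of_ne hkj.symm, inner_smul_right] at this
    have h3 : (1 / 2 : ℝ) < ‖w k + w j‖⁻¹ := by
      rw [one_div]
      exact (inv_lt_inv₀ two_pos (norm_pos_iff.2 hne)).2 hlt
    have h4 := mul_lt_mul_of_pos_right h3 hsum
    rw [inner_add_right] at h4 this
    linarith
  refine ⟨w k, hwK.1 k, ?_, hk.ne'⟩
  rw [← hwK.2]
  congr 2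
  funext j
  exact (hall j).symm

end Banach

/-! ### Decomposable tensors and powers of linear forms -/

section Veronese

variable {n d : ℕ}

lemma prod_update_coord [DecidableEq (Fin d)] (v : Fin d → EuclideanSpace ℝ (Fin (n + 1)))
    (k : Fin d) (z : EuclideanSpace ℝ (Fin (n + 1))) (i : Fin d → Fin (n + 1)) :
    ∏ l, Function.update v k z l (i l) = z (i k) * ∏ l ∈ Finset.univ.erase k, v l (i l) := by
  rw [← Finset.mul_prod_erase _ _ (Finset.mem_univ k), Function.update_self]
  congr 1
  exact Finset.prod_congr rfl fun l hl => by rw [Function.update_of_ne (Finset.ne_of_mem_erase hl)]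

/-- The decomposable tensor `v_1 ⊗ ⋯ ⊗ v_d`, as a multilinear function of its factors. -/
noncomputable def decomposable (n d : ℕ) :
    MultilinearMap ℝ (fun _ : Fin d => EuclideanSpace ℝ (Fin (n + 1))) (Tensor n d) where
  toFun v := WithLp.toLp 2 fun i => ∏ k, v k (i k)
  map_update_add' v k x y := by
    ext i
    simp only [PiLp.add_apply, prod_update_coord, add_mul]
  map_update_smul' v k c x := by
    ext i
    simp only [PiLp.smul_apply, smul_eq_mul, prod_update_coord, mul_assoc]

lemma decomposable_apply (v : Fin d → EuclideanSpace ℝ (Fin (n + 1))) (i : Fin d → Fin (n + 1)) :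
    decomposable n d v i = ∏ k, v k (i k) := rfl

lemma continuous_decomposable : Continuous (decomposable n d) := by
  refine (PiLp.continuous_toLp 2 _).comp (continuous_pi fun i => ?_)
  fun_prop

lemma mem_rankOneTensors_iff {S : Tensor n d} :
    S ∈ rankOneTensors n d ↔ ∃ v, S = decomposable n d v := by
  constructor
  · rintro ⟨v, hv⟩
    exact ⟨fun k => WithLp.toLp 2 (v k), by ext i; exact hv i⟩
  · rintro ⟨v, rfl⟩
    exact ⟨fun k => v k, fun i => rfl⟩

lemma inner_decomposable (u v : Fin d → EuclideanSpace ℝ (Fin (n + 1))) :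
    ⟪decomposable n d u, decomposable n d v⟫ = ∏ k, ⟪u k, v k⟫ := by
  simp only [PiLp.inner_apply, decomposable_apply, Finset.prod_univ_sum, Fintype.piFinset_univ]
  simp [Finset.prod_mul_distrib]

lemma norm_decomposable (v : Fin d → EuclideanSpace ℝ (Fin (n + 1))) :
    ‖decomposable n d v‖ = ∏ k, ‖v k‖ := by
  rw [← sq_eq_sq₀ (norm_nonneg _) (Finset.prod_nonneg fun _ _ => norm_nonneg _),
    ← real_inner_self_eq_norm_sq, inner_decomposable, ← Finset.prod_pow]
  simp only [real_inner_self_eq_norm_sq]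

lemma smul_mem_rankOneTensors (hd : d ≠ 0) {S : Tensor n d} (hS : S ∈ rankOneTensors n d) (c : ℝ) :
    c • S ∈ rankOneTensors n d := by
  obtain ⟨v, rfl⟩ := mem_rankOneTensors_iff.1 hS
  let k : Fin d := ⟨0, Nat.pos_of_ne_zero hd⟩
  refine mem_rankOneTensors_iff.2 ⟨Function.update v k (c • v k), ?_⟩
  rw [MultilinearMap.map_update_smul, Function.update_eq_self]

lemma isSymmetric_smul_decomposable (c : ℝ) (y : EuclideanSpace ℝ (Fin (n + 1))) :
    IsSymmetric (c • decomposable n d fun _ => y) := fun σ i => by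
  simp only [PiLp.smul_apply, decomposable_apply, Function.comp_apply,
    Equiv.prod_comp σ fun k => y (i k)]

lemma inner_decomposable_comp_perm {T : Tensor n d} (hT : IsSymmetric T) (σ : Equiv.Perm (Fin d))
    (v : Fin d → EuclideanSpace ℝ (Fin (n + 1))) :
    ⟪T, decomposable n d (v ∘ σ)⟫ = ⟪T, decomposable n d v⟫ := by
  simp only [PiLp.inner_apply, decomposable_apply]
  rw [← Equiv.sum_comp (Equiv.arrowCongr σ.symm (Equiv.refl (Fin (n + 1))))]
  refine Finset.sum_congr rfl fun i _ => ?_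
  have h1 : (Equiv.arrowCongr σ.symm (Equiv.refl (Fin (n + 1)))) i = i ∘ σ := rfl
  rw [h1, hT, ← Equiv.prod_comp σ fun k => (v k) (i k)]
  rfl

lemma polyOfTensor_smul (c : ℝ) (S : Tensor n d) :
    polyOfTensor (c • S) = c • polyOfTensor S := by
  apply Subtype.ext
  simp only [polyOfTensor, SetLike.val_smul, PiLp.smul_apply, smul_eq_mul, map_mul,
    MvPolynomial.smul_eq_C_mul, Finset.mul_sum, mul_assoc]

lemma polyOfTensor_decomposable (y : EuclideanSpace ℝ (Fin (n + 1))) :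
    polyOfTensor (decomposable n d fun _ => y) = linearPow n d y := by
  apply Subtype.ext
  simp only [polyOfTensor, linearPow, decomposable_apply, map_prod, ← Finset.prod_mul_distrib]
  exact (Fintype.sum_pow (fun i => MvPolynomial.C (y i) * MvPolynomial.X i) d).symm

lemma linearPow_smul (c : ℝ) (y : EuclideanSpace ℝ (Fin (n + 1))) :
    linearPow n d (c • y).ofLp = c ^ d • linearPow n d y := by
  rw [← polyOfTensor_decomposable, ← polyOfTensor_decomposable, ← polyOfTensor_smul,
    MultilinearMap.map_smul_univ (decomposable n d) (fun _ => c) fun _ => y]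
  simp

/-- The reproducing property of the Bombieri–Weyl scalar product: the scalar product with the power
of a linear form is evaluation at the coefficient vector of that form. -/
lemma inner_linearPow (p : HomPoly n d) (v : Fin (n + 1) → ℝ) :
    ⟪p, linearPow n d v⟫ = MvPolynomial.eval v p.1 := by
  change bwInner p (linearPow n d v) = _
  have hsum (α : Fin (n + 1) →₀ ℕ) : (α.sum fun _ m => m) = Finset.univ.sum α :=
    Finsupp.sum_fintype _ _ fun _ => rfl
  have hsub : p.1.support ⊆ Finset.finsuppAntidiag Finset.univ d := fun α hα => by
    refine Finset.mem_finsuppAntidiag.2 ⟨?_, Finset.subset_univ _⟩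
    have h : α.degree = d := by
      rw [Finsupp.degree_eq_weight_one]
      exact p.2 (MvPolynomial.mem_support_iff.1 hα)
    rw [← h, Finsupp.degree_eq_sum]
  rw [MvPolynomial.eval_eq', bwInner, Finset.sum_subset hsub fun α _ hα => by
    rw [MvPolynomial.notMem_support_iff.1 hα, zero_mul]]
  refine Finset.sum_congr rfl fun α hα => ?_
  have hα' := (Finset.mem_finsuppAntidiag.1 hα).1
  have hcoeff : (linearPow n d v).1.coeff α = α.multinomial * ∏ i, v i ^ α i := by
    simp only [linearPow, ← MvPolynomial.smul_eq_C_mul]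
    rw [MvPolynomial.coeff_linearCombination_X_pow_of_fintype, if_pos ((hsum α).trans hα'),
      Finsupp.prod_fintype _ _ fun _ => pow_zero _]
  rw [hcoeff]
  have := (multinomial_pos α).ne'
  field_simp

lemma inner_polyOfTensor_linearPow (S : Tensor n d) (y : EuclideanSpace ℝ (Fin (n + 1))) :
    ⟪polyOfTensor S, linearPow n d y⟫ = ⟪S, decomposable n d fun _ => y⟫ := by
  rw [inner_linearPow]
  simp [polyOfTensor, PiLp.inner_apply, decomposable_apply, mul_comm]

lemma inner_linearPow_linearPow (x y : EuclideanSpace ℝ (Fin (n + 1))) :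
    ⟪linearPow n d x, linearPow n d y⟫ = ⟪x, y⟫ ^ d := by
  rw [← polyOfTensor_decomposable, inner_polyOfTensor_linearPow, inner_decomposable]
  simp

lemma norm_linearPow (y : EuclideanSpace ℝ (Fin (n + 1))) : ‖linearPow n d y‖ = ‖y‖ ^ d := by
  rw [← sq_eq_sq₀ (norm_nonneg _) (by positivity), ← real_inner_self_eq_norm_sq,
    inner_linearPow_linearPow, real_inner_self_eq_norm_sq, pow_right_comm]

lemma smul_linearPow_mem_veroneseVariety (hd : d ≠ 0) (c : ℝ)
    (y : EuclideanSpace ℝ (Fin (n + 1))) : c • linearPow n d y ∈ veroneseVariety n d := by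
  refine ⟨((|c| ^ (d⁻¹ : ℝ)) • y : EuclideanSpace ℝ (Fin (n + 1))), ?_⟩
  rw [linearPow_smul, Real.rpow_inv_natCast_pow (abs_nonneg c) hd, ← neg_smul]
  rcases abs_choice c with h | h
  · exact Or.inl (by rw [h])
  · exact Or.inr (by rw [h, neg_neg])

lemma exists_eq_smul_linearPow {q : HomPoly n d} (hq : q ∈ veroneseVariety n d) :
    ∃ (c : ℝ) (y : EuclideanSpace ℝ (Fin (n + 1))), q = c • linearPow n d y := by
  obtain ⟨v, h | h⟩ := hq
  · exact ⟨1, WithLp.toLp 2 v, by rw [h, one_smul]⟩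
  · exact ⟨-1, WithLp.toLp 2 v, by rw [h, neg_one_smul]⟩

end Veronese

end SymTensor

/-! ### Uniqueness and symmetry of the best rank-one approximation -/

open SymTensor in
theorem mainTheorem6 (n d : ℕ) (hn : 1 ≤ n) (hd : 2 ≤ d)
    (T : SymTensor.Tensor n d) (hT : SymTensor.IsSymmetric T)
    (hdist : Metric.infDist (SymTensor.polyOfTensor T) (SymTensor.veroneseVariety n d) <
      Real.sin (SymTensor.sphericalReach (SymTensor.sphericalVeronese n d)) *
        ‖SymTensor.polyOfTensor T‖) :
    (∃! q : SymTensor.HomPoly n d,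
      SymTensor.IsBestApprox (SymTensor.veroneseVariety n d) (SymTensor.polyOfTensor T) q) ∧
    (∃! S : SymTensor.Tensor n d,
      SymTensor.IsBestApprox (SymTensor.rankOneTensors n d) T S) ∧
    (∀ S : SymTensor.Tensor n d,
      SymTensor.IsBestApprox (SymTensor.rankOneTensors n d) T S →
        SymTensor.IsSymmetric S ∧
        SymTensor.IsBestApprox (SymTensor.veroneseVariety n d) (SymTensor.polyOfTensor T)
          (SymTensor.polyOfTensor S)) := by
  have hd0 : d ≠ 0 := by omega
  set p := polyOfTensor T
  set F : MultilinearMap ℝ (fun _ : Fin d => EuclideanSpace ℝ (Fin (n + 1))) ℝ :=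
    (innerₛₗ ℝ T).compMultilinearMap (decomposable n d)
  have hFapp : ∀ v, ⟪T, decomposable n d v⟫ = F v := fun v => rfl
  have hFp : ∀ y : EuclideanSpace ℝ (Fin (n + 1)), ⟪p, linearPow n d y⟫ = F fun _ => y := inner_polyOfTensor_linearPow T
  have hcont : Continuous F := continuous_const.inner continuous_decomposable
  have hsymm : ∀ (σ : Equiv.Perm (Fin d)) v, F (v ∘ σ) = F v := inner_decomposable_comp_perm hT
  obtain ⟨v, hv, hle⟩ := exists_unit_abs_map_max hcont
  obtain ⟨L, hFv⟩ : ∃ L, |F v| = L := ⟨_, rfl⟩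
  rw [hFv] at hle
  have hL : 0 ≤ L := hFv ▸ abs_nonneg _
  have hbound := abs_map_le_mul_prod_norm hle
  -- Banach's theorem: the norm `L` of `F` is attained at a diagonal tuple
  obtain ⟨x, hx, hFx, -⟩ := exists_diagonal_abs_map_eq hcont hsymm hle hv hFv
    (i := ⟨0, Nat.pos_of_ne_zero hd0⟩) (h := v ⟨0, Nat.pos_of_ne_zero hd0⟩) (by
      rw [real_inner_self_eq_norm_sq, hv]
      norm_num)
  set a := F fun _ => x
  have hsq : ∀ {b : ℝ}, |b| = L → b * b = L ^ 2 := fun {b} hb => by rw [← hb, sq_abs, sq]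
  -- `a` is `L` up to sign, so `sign a` turns `x ⊗ ⋯ ⊗ x` into a unit vector on which `T` is `L`
  obtain ⟨s, hs, hsa⟩ : ∃ s : ℝ, |s| = 1 ∧ s * a = L := by
    rcases abs_choice a with h | h
    · exact ⟨1, by simp, by rw [one_mul, ← h, hFx]⟩
    · exact ⟨-1, by simp, by rw [neg_one_mul, ← h, hFx]⟩
  have hCV : ∀ q ∈ veroneseVariety n d, ∀ c : ℝ, c • q ∈ veroneseVariety n d := fun q hq c => by
    obtain ⟨b, y, rfl⟩ := exists_eq_smul_linearPow hq
    rw [smul_smul]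
    exact smul_linearPow_mem_veroneseVariety hd0 _ _
  have hleV : ∀ q ∈ veroneseVariety n d, ⟪p, q⟫ ≤ L * ‖q‖ := fun q hq => by
    obtain ⟨b, y, rfl⟩ := exists_eq_smul_linearPow hq
    have h := hbound fun _ => y
    rw [Finset.prod_const, Finset.card_univ, Fintype.card_fin] at h
    rw [inner_smul_right, hFp, norm_smul, norm_linearPow, Real.norm_eq_abs]
    calc b * F (fun _ => y) ≤ |b| * |F fun _ => y| := by rw [← abs_mul]; exact le_abs_self _
      _ ≤ |b| * (L * ‖y‖ ^ d) := by gcongr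
      _ = L * (|b| * ‖y‖ ^ d) := by ring
  have huV := smul_linearPow_mem_veroneseVariety hd0 s x
  have huV1 : ‖s • linearPow n d x‖ = 1 := by
    rw [norm_smul, norm_linearPow, hx, Real.norm_eq_abs, hs, one_pow, one_mul]
  have huVL : ⟪p, s • linearPow n d x⟫ = L := by rw [inner_smul_right, hFp, hsa]
  have hbestV {q} := isBestApprox_cone_iff hL hCV hleV huV huV1 huVL (q := q)
  have hCR : ∀ S ∈ rankOneTensors n d, ∀ c : ℝ, c • S ∈ rankOneTensors n d := fun S hS c =>
    smul_mem_rankOneTensors hd0 hS c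
  have hleR : ∀ S ∈ rankOneTensors n d, ⟪T, S⟫ ≤ L * ‖S‖ := fun S hS => by
    obtain ⟨w, rfl⟩ := mem_rankOneTensors_iff.1 hS
    rw [norm_decomposable]
    exact (le_abs_self _).trans (hbound w)
  have hxR : (decomposable n d fun _ => x) ∈ rankOneTensors n d := mem_rankOneTensors_iff.2 ⟨fun _ => x, rfl⟩
  have hx1 : ‖decomposable n d fun _ => x‖ = 1 := by simp [norm_decomposable, hx]
  have hbestR {S} := isBestApprox_cone_iff hL hCR hleR (hCR _ hxR s)
    (by rw [norm_smul, hx1, Real.norm_eq_abs, hs, one_mul])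
    (by rw [inner_smul_right, hFapp, hsa]) (q := S)
  obtain ⟨hLpos, huniq⟩ := eq_of_infDist_lt_sin_sphericalReach hL hCV hleV huV huV1 huVL hdist
  have ha0 : a ≠ 0 := abs_pos.1 (hFx ▸ hLpos)
  have hdiag : ∀ y, ‖y‖ = 1 → |F fun _ => y| = L →
      IsBestApprox (veroneseVariety n d) p ((F fun _ => y) • linearPow n d y) := by
    intro y hy hFy
    refine hbestV.2 ⟨smul_linearPow_mem_veroneseVariety hd0 _ _, ?_, ?_⟩
    · rw [norm_smul, norm_linearPow, hy, one_pow, mul_one, Real.norm_eq_abs, hFy]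
    · rw [inner_smul_right, hFp, hsq hFy]
  -- a vector orthogonal to `x` is orthogonal to all factors of all maximizing unit tuples, as
  -- otherwise it is not orthogonal to some diagonal one, which is `(±x, …, ±x)` by uniqueness
  have horth : ∀ h, ⟪x, h⟫ = 0 → ∀ w : Fin d → EuclideanSpace ℝ (Fin (n + 1)),
      (∀ k, ‖w k‖ = 1) → |F w| = L → ∀ k, ⟪h, w k⟫ = 0 := by
    intro h hxh w hw hFw k
    by_contra hk
    obtain ⟨y, hy, hFy, hhy⟩ := exists_diagonal_abs_map_eq hcont hsymm hle hw hFw hk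
    have heq := congrArg (fun q => ⟪q, linearPow n d h⟫)
      (huniq _ _ (hdiag y hy hFy) (hdiag x hx hFx))
    simp only [inner_smul_left, inner_linearPow_linearPow, conj_trivial, hxh, zero_pow hd0,
      mul_zero] at heq
    rcases mul_eq_zero.1 heq with h0 | h0
    · rw [h0, abs_zero] at hFy
      exact hLpos.ne hFy
    · exact hhy (by rw [real_inner_comm]; exact pow_eq_zero_iff hd0 |>.1 h0)
  have huniqR : ∀ S, IsBestApprox (rankOneTensors n d) T S →
      S = a • decomposable n d fun _ => x := by
    intro S hS
    obtain ⟨hSR, hS1, hS2⟩ := hbestR.1 hS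
    obtain ⟨w, rfl⟩ := mem_rankOneTensors_iff.1 hSR
    rw [norm_decomposable] at hS1
    rw [hFapp] at hS2
    have hw0 : ∀ k, ‖w k‖ ≠ 0 := fun k h0 =>
      hLpos.ne ((Finset.prod_eq_zero (Finset.mem_univ k) h0).symm.trans hS1)
    have hFe : |F fun k => ‖w k‖⁻¹ • w k| = L := by
      rw [F.map_smul_univ, hS2, Finset.prod_inv_distrib, hS1, smul_eq_mul, sq,
        inv_mul_cancel_left₀ hLpos.ne', abs_of_pos hLpos]
    have hspan : ∀ k, w k = ⟪x, w k⟫ • x := by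
      intro k
      have hxh : ⟪x, w k - ⟪x, w k⟫ • x⟫ = 0 := by
        rw [inner_sub_right, inner_smul_right, real_inner_self_eq_norm_sq, hx]
        ring
      have h1 := horth _ hxh (fun k => ‖w k‖⁻¹ • w k)
        (fun k => by rw [norm_smul, norm_inv, norm_norm, inv_mul_cancel₀ (hw0 k)]) hFe k
      rw [inner_smul_right] at h1
      have h2 := (mul_eq_zero.1 h1).resolve_left (inv_ne_zero (hw0 k))
      rw [← sub_eq_zero, ← inner_self_eq_zero (𝕜 := ℝ), inner_sub_right, h2, inner_smul_right,
        real_inner_comm x (w k - _), hxh, mul_zero, sub_zero]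
    have hw : decomposable n d w = (∏ k, ⟪x, w k⟫) • decomposable n d fun _ => x := by
      rw [← MultilinearMap.map_smul_univ]
      exact congrArg _ (funext hspan)
    have hc : (∏ k, ⟪x, w k⟫) * a = a * a := by
      rw [hsq hFx, ← hS2, ← hFapp w, hw, inner_smul_right, hFapp]
    rw [hw, mul_right_cancel₀ ha0 hc]
  refine ⟨⟨_, hdiag x hx hFx, fun q hq => huniq _ _ hq (hdiag x hx hFx)⟩,
    ⟨_, hbestR.2 ⟨hCR _ hxR a, ?_, ?_⟩, huniqR⟩, fun S hS => ?_⟩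
  · rw [norm_smul, hx1, mul_one, Real.norm_eq_abs, hFx]
  · rw [inner_smul_right, hFapp, hsq hFx]
  · rw [huniqR S hS, polyOfTensor_smul, polyOfTensor_decomposable]
    exact ⟨isSymmetric_smul_decomposable a x, hdiag x hx hFx⟩
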